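/- Let $N\ge 3$. Regard $[0,1]$ with $0$ and $1$ identified as a circle of length $1$, with distance $d(u,v)=\min(|v-u|,1-|v-u|)$. For a configuration $s=(s_1,\dots,s_N)\in[0,1]^N$ of $N$ drivers with sorted positions $s_{(1)}\le\dots\le s_{(N)}$, let $\ell(s)=(\ell_1,\dots,\ell_N)$ be the vector of lengths of the arcs between consecutive drivers, that is, $\ell_k=s_{(k+1)}-s_{(k)}$ for $k<N$ and $\ell_N=1-s_{(N)}+s_{(1)}$, and let $V(\ell)=\sum_{k=1}^N\ell_k^2$. In one step of the greedy dynamics, a user arrives at a point $x$ and is assigned to a driver $k^*$ with $d(x,s_{k^*})=\min_k d(x,s_k)$ (ties broken arbitrarily), and that driver is replaced by a new driver at a point $y$. The new configuration is $s'=(s_1,\dots,s_{k^*-1},y,s_{k^*+1},\dots,s_N)$, with gap vector $\ell'=\ell(s')$. The points $x$ and $y$ are uniform on $[0,1]$, independent of each other and of $s$. Let $\Delta V(\ell)=\mathbb{E}[V(\ell')-V(\ell)\mid \ell]$. If $s_1,\dots,s_N$ are independent and uniformly distributed on $[0,1]$, then $$\mathbb{E}\big[\Delta V(\ell(s))\big]>0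 .$$ -/

import Mathlib

open MeasureTheory ProbabilityTheory

noncomputable section

namespace GreedyCircle

/-- The circle of length one is `[0,1]` with `0` and `1` identified; this is its arc distance
`d(u,v) = min(|v-u|, 1-|v-u|)`. -/
def arcDist (u v : unitInterval) : ℝ :=
  min |(v : ℝ) - (u : ℝ)| (1 - |(v : ℝ) - (u : ℝ)|)

/-- The positions of the `N` drivers, relabelled in nondecreasing order. -/
def sortedPos {N : ℕ} (s : Fin N → unitInterval) : Fin N → unitInterval :=
  fun k => s (Tuple.sort s k)

/-- The gap vector of the configuration `s`: entry `k` is the length of the arc from the `k`-th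
driver (in sorted order) to the next one; the last arc wraps around through `1 = 0`. -/
def gaps {N : ℕ} (s : Fin N → unitInterval) (k : Fin N) : ℝ :=
  if h : (k : ℕ) + 1 < N then
    (sortedPos s ⟨(k : ℕ) + 1, h⟩ : ℝ) - (sortedPos s k : ℝ)
  else
    1 - (sortedPos s k : ℝ) + (sortedPos s ⟨0, k.pos⟩ : ℝ)

/-- The function `V(ℓ) = ∑ ℓ_k²`. -/
def V {N : ℕ} (l : Fin N → ℝ) : ℝ :=
  ∑ k, l k ^ 2

/-- Driver `k` is closest to a user at `x`, so that the greedy rule may assign it. -/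
def IsNearest {N : ℕ} (s : Fin N → unitInterval) (x : unitInterval) (k : Fin N) : Prop :=
  ∀ j : Fin N, arcDist x (s k) ≤ arcDist x (s j)

/-- The next configuration: the assigned driver `k` is replaced by a new driver at `y`. -/
def nextPos {N : ℕ} (s : Fin N → unitInterval) (k : Fin N) (y : unitInterval) :
    Fin N → unitInterval :=
  Function.update s k y

/-- The expected one-step change `ΔV(ℓ) = E[V(ℓ') - V(ℓ) | ℓ]`, a random variable on `Ω`, when the
drivers are at `S`, driver `K` is assigned, and the new driver appears at `Y`. It is the
conditional expectation with respect to the sigma-algebra generated by the gap vector of `S`. -/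
def deltaV {Ω : Type*} [MeasurableSpace Ω] (μ : Measure Ω) {N : ℕ}
    (S : Ω → Fin N → unitInterval) (K : Ω → Fin N) (Y : Ω → unitInterval) : Ω → ℝ :=
  μ[fun ω => V (gaps (nextPos (S ω) (K ω) (Y ω))) - V (gaps (S ω)) |
    MeasurableSpace.comap (fun ω => gaps (S ω)) inferInstance]

end GreedyCircle

end

/-!
The gaps enter `V` only through a random arc: choose an endpoint `u` uniformly on the circle and a
length `w` uniformly in `(0,1)`, and delete from the circle the closed arc of length `w` that ends
at `u`. What is left, `arc w u`, contains all drivers exactly if `w` is less than the distance from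
`u` back to the previous driver, and that distance has integral `ℓₖ² / 2` over the `k`-th gap. Hence
`V (gaps s)` is twice the probability that the random arc contains all drivers (`ofReal_V_gaps`).
For `N` independent uniform drivers the expectation of `V` is therefore `2 ∫ (1-w)^N dw = 2/(N+1)`
(`lintegral_energy`).

After the replacement of the assigned driver `k`, the random arc contains all drivers if it contains
the new one and either it contained all `N` drivers, or it contained all of them but `k`
(`arcLaw_add_sum_le_energy_update`). With `h = 1 - w`, the first case has probability `h^(N+1)`
given `w`. In the second case rotation invariance moves driver `k` to the origin
(`lintegral_removalWeight`). The arc is then an interval `(a, a+h)` with `0 < a < w`, and a user at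
`ξ` is assigned to the driver at the origin if the interval `(0, 2ξ)`, for `ξ < 1/2`, or
`(2ξ-1, 1)`, for `ξ > 1/2`, contains no other driver. Integrating over `ξ` the probability that the
`N-1` other drivers are in the rest of the arc gives `w h^(N-1) / 2 + h^N / N` for every `a`
(`ofReal_le_lintegral_removalWeight`). Altogether the expectation of `V` after the step is at least
`2 ∫ (h^(N+1) + N h w (w h^(N-1) / 2 + h^N / N)) dw`, which exceeds `2/(N+1)` by
`2(N-2) / ((N+1)(N+2)(N+3)) > 0` (`integral_energy_density`).

Since the assigned driver is not required to depend measurably on the outcome, the integrability of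
the new energy uses that the closest driver is almost surely unique (`ae_no_tie`).
-/

noncomputable section

namespace GreedyCircle

open Set
open scoped ENNReal

/-! ### Coordinates and arcs on the circle -/

/-- The quotient map from `[0,1]` to the circle `ℝ / ℤ`, identifying `0` and `1`. -/
def toCircle (x : unitInterval) : UnitAddCircle := ((x : ℝ) : UnitAddCircle)

/-- The representative in `[0,1)` of a point of the circle `ℝ / ℤ`. -/
def coord (t : UnitAddCircle) : ℝ := (AddCircle.equivIco 1 0 t : ℝ)

lemma coord_coe (x : ℝ) : coord (x : UnitAddCircle) = Int.fract x := by
  have := AddCircle.coe_equivIco_mk_apply (p := (1 : ℝ)) x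
  simpa only [coord, div_one, mul_one] using this

lemma measurable_coord : Measurable coord :=
  measurable_subtype_coe.comp (AddCircle.measurableEquivIco 1 0).measurable

lemma measurePreserving_toCircle : MeasurePreserving toCircle := by
  have h1 := unitInterval.measurePreserving_coe
  have h2 := UnitAddCircle.measurePreserving_mk 0
  rw [zero_add,
    Measure.restrict_congr_set (Ioc_ae_eq_Icc (μ := volume) (a := (0 : ℝ)) (b := 1))] at h2
  exact h2.comp h1

lemma arcDist_eq_norm (x y : unitInterval) : arcDist x y = ‖toCircle x - toCircle y‖ := by
  have : toCircle x - toCircle y = (((x : ℝ) - y : ℝ) : UnitAddCircle) := by simp [toCircle]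
  rw [this, UnitAddCircle.norm_eq, abs_sub_round_eq_min, arcDist]
  obtain ⟨hx0, hx1⟩ := x.2
  obtain ⟨hy0, hy1⟩ := y.2
  rcases eq_or_lt_of_le hx1 with h | h
  · rcases eq_or_lt_of_le hy0 with h' | h'
    · simp [h, ← h']
    · rw [Int.fract_eq_self.2 ⟨by linarith, by linarith⟩, abs_sub_comm, abs_of_nonneg]
      linarith
  · rcases le_or_gt (y : ℝ) x with h' | h'
    · rw [Int.fract_eq_self.2 ⟨by linarith, by linarith⟩, abs_sub_comm, abs_of_nonneg]
      linarith
    · rcases eq_or_lt_of_le hy1 with h'' | h''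
      · rcases eq_or_lt_of_le hx0 with h3 | h3
        · have : Int.fract (-1 : ℝ) = 0 := Int.fract_eq_zero_iff.2 ⟨-1, by simp⟩
          simp [h'', ← h3, this]
        · have : Int.fract ((x : ℝ) - y) = x - y + 1 :=
            Int.fract_eq_iff.2 ⟨by linarith, by linarith, -1, by push_cast; ring⟩
          rw [this, abs_of_nonneg (by linarith), min_comm]
          congr 1 <;> ring
      · have : Int.fract ((x : ℝ) - y) = x - y + 1 :=
          Int.fract_eq_iff.2 ⟨by linarith, by linarith, -1, by push_cast; ring⟩
        rw [this, abs_of_nonneg (by linarith), min_comm]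
        congr 1 <;> ring

/-- The arc obtained from the circle by deleting the closed arc of length `w` that ends at `u`.
For `w ∈ [0,1)` it has length `1 - w`. -/
def arc (w : ℝ) (u : UnitAddCircle) : Set UnitAddCircle := {p | w < coord (u - p)}

lemma mem_arc {w : ℝ} {u p : UnitAddCircle} : p ∈ arc w u ↔ w < coord (u - p) := Iff.rfl

lemma sub_mem_arc_sub {w : ℝ} {u p z : UnitAddCircle} : p - z ∈ arc w (u - z) ↔ p ∈ arc w u := by
  simp [mem_arc]

lemma measurableSet_arc (w : ℝ) (u : UnitAddCircle) : MeasurableSet (arc w u) :=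
  measurableSet_lt measurable_const (measurable_coord.comp (measurable_const.sub measurable_id))

lemma volume_eq_volume_Ioc_inter (t : ℝ) {A : Set UnitAddCircle} (hA : MeasurableSet A) :
    volume A = volume (Ioc t (t + 1) ∩ ((↑) : ℝ → UnitAddCircle) ⁻¹' A) := by
  rw [← (UnitAddCircle.measurePreserving_mk t).measure_preimage hA.nullMeasurableSet,
    Measure.restrict_apply (AddCircle.measurable_mk' hA), inter_comm]

lemma volume_arc {w : ℝ} (hw : w ∈ Ioo (0 : ℝ) 1) (u : UnitAddCircle) :
    volume (arc w u) = ENNReal.ofReal (1 - w) := by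
  have h : arc w u = (fun p => u - p) ⁻¹' {p | w < coord p} := rfl
  have hm : MeasurableSet {p | w < coord p} := measurableSet_lt measurable_const measurable_coord
  rw [h, (volume.measurePreserving_sub_left u).measure_preimage hm.nullMeasurableSet,
    volume_eq_volume_Ioc_inter 0 hm]
  have : Ioc (0 : ℝ) (0 + 1) ∩ ((↑) : ℝ → UnitAddCircle) ⁻¹' {p | w < coord p} = Ioo w 1 := by
    ext x
    simp only [zero_add, mem_inter_iff, mem_Ioc, mem_preimage, mem_ofPred_eq, coord_coe, mem_Ioo]
    constructor
    · rintro ⟨⟨h0, h1⟩, h2⟩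
      rcases eq_or_lt_of_le h1 with h | h
      · simp [h] at h2; linarith [hw.1]
      · rw [Int.fract_eq_self.2 ⟨h0.le, h⟩] at h2
        exact ⟨h2, h⟩
    · rintro ⟨h1, h2⟩
      have h0 : 0 < x := hw.1.trans h1
      rw [Int.fract_eq_self.2 ⟨h0.le, h2⟩]
      exact ⟨⟨h0, h2.le⟩, h1⟩
  rw [this, Real.volume_Ioo]

/-! ### The gap energy as the measure of a set of arcs -/

/-- The law of a uniform pair `(u, w)` of an endpoint on the circle and a length in `(0,1)`. -/
def arcLaw : Measure (UnitAddCircle × ℝ) :=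
  (volume : Measure UnitAddCircle).prod (volume.restrict (Ioo (0 : ℝ) 1))

instance : IsFiniteMeasure arcLaw := by unfold arcLaw; infer_instance

/-- Twice the probability that all the points `t i` lie in the random arc `arc w u`. -/
def energy {ι : Type*} (t : ι → UnitAddCircle) : ℝ≥0∞ :=
  2 * ∫⁻ q, {t : ι → UnitAddCircle | ∀ i, t i ∈ arc q.2 q.1}.indicator 1 t ∂arcLaw

lemma measurableSet_mem_arc {α ι : Type*} [MeasurableSpace α] [Countable ι]
    {f : ι → α → UnitAddCircle} (hf : ∀ i, Measurable (f i)) {u : α → UnitAddCircle}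
    (hu : Measurable u) {w : α → ℝ} (hw : Measurable w) :
    MeasurableSet {a | ∀ i, f i a ∈ arc (w a) (u a)} := by
  rw [ofPred_forall]
  exact MeasurableSet.iInter fun i =>
    measurableSet_lt hw (measurable_coord.comp (hu.sub (hf i)))

lemma measurable_energy {ι : Type*} [Countable ι] :
    Measurable (energy : (ι → UnitAddCircle) → ℝ≥0∞) := by
  refine Measurable.const_mul (Measurable.lintegral_prod_right'
    (f := fun a : (ι → UnitAddCircle) × (UnitAddCircle × ℝ) =>
      {t : ι → UnitAddCircle | ∀ i, t i ∈ arc a.2.2 a.2.1}.indicator 1 a.1) ?_) 2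
  have : MeasurableSet {a : (ι → UnitAddCircle) × (UnitAddCircle × ℝ) |
      ∀ i, a.1 i ∈ arc a.2.2 a.2.1} :=
    measurableSet_mem_arc (fun i => (measurable_pi_apply i).comp measurable_fst) (by fun_prop)
      (by fun_prop)
  exact (measurable_one.indicator this)

lemma energy_le_two {ι : Type*} (t : ι → UnitAddCircle) : energy t ≤ 2 := by
  have : ∫⁻ q, {t : ι → UnitAddCircle | ∀ i, t i ∈ arc q.2 q.1}.indicator 1 t ∂arcLaw
      ≤ ∫⁻ _, 1 ∂arcLaw := by
    refine lintegral_mono fun q => ?_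
    exact indicator_le_self' (fun _ _ => zero_le) t
  have h1 : ∫⁻ _, 1 ∂arcLaw = 1 := by
    simp [arcLaw, Measure.prod_apply MeasurableSet.univ]
  calc energy t ≤ 2 * 1 := by unfold energy; gcongr; exact this.trans h1.le
    _ = 2 := mul_one 2

/-- The `k`-th driver in sorted order, continued past the last one by the first driver shifted by a
full turn, so that each gap is a difference of consecutive terms. -/
def unrolledPos {N : ℕ} [NeZero N] (s : Fin N → unitInterval) (k : ℕ) : ℝ :=
  if h : k < N then (sortedPos s ⟨k, h⟩ : ℝ) else (sortedPos s 0 : ℝ) + 1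

lemma monotone_sortedPos {N : ℕ} (s : Fin N → unitInterval) : Monotone (sortedPos s) :=
  Tuple.monotone_sort s

lemma unrolledPos_of_lt {N : ℕ} [NeZero N] (s : Fin N → unitInterval) {k : ℕ} (h : k < N) :
    unrolledPos s k = sortedPos s ⟨k, h⟩ := dif_pos h

lemma unrolledPos_self {N : ℕ} [NeZero N] (s : Fin N → unitInterval) :
    unrolledPos s N = unrolledPos s 0 + 1 := by
  rw [unrolledPos_of_lt s (NeZero.pos N), unrolledPos, dif_neg (lt_irrefl N)]; rfl

lemma unrolledPos_mem {N : ℕ} [NeZero N] (s : Fin N → unitInterval) {k : ℕ} (h : k < N) :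
    unrolledPos s k ∈ Icc (0 : ℝ) 1 := by
  rw [unrolledPos_of_lt s h]; exact (sortedPos s _).2

lemma monotone_unrolledPos {N : ℕ} [NeZero N] (s : Fin N → unitInterval) :
    Monotone (unrolledPos s) := by
  intro i j hij
  by_cases hj : j < N
  · rw [unrolledPos_of_lt s hj, unrolledPos_of_lt s (hij.trans_lt hj)]
    exact monotone_sortedPos s (by simpa using hij)
  · have hj' : unrolledPos s j = (sortedPos s 0 : ℝ) + 1 := dif_neg hj
    by_cases hi : i < N
    · rw [hj']
      linarith [(unrolledPos_mem s hi).2, (sortedPos s 0).2.1]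
    · rw [hj', unrolledPos, dif_neg hi]

lemma gaps_eq_sub {N : ℕ} [NeZero N] (s : Fin N → unitInterval) (k : Fin N) :
    gaps s k = unrolledPos s (k + 1) - unrolledPos s k := by
  unfold gaps
  split_ifs with h
  · rw [unrolledPos_of_lt s h, unrolledPos_of_lt s k.2]
  · have hk : (k : ℕ) + 1 = N := by omega
    rw [hk, unrolledPos_self, unrolledPos_of_lt s (NeZero.pos N), unrolledPos_of_lt s k.2]
    ring

lemma lintegral_Ioc_eq_sum {p : ℕ → ℝ} (hp : Monotone p) (f : ℝ → ℝ≥0∞) (n : ℕ) :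
    ∫⁻ x in Ioc (p 0) (p n), f x = ∑ k ∈ Finset.range n, ∫⁻ x in Ioc (p k) (p (k + 1)), f x := by
  induction n with
  | zero => simp
  | succ n ih =>
    rw [Finset.sum_range_succ, ← ih, ← lintegral_union measurableSet_Ioc,
      Ioc_union_Ioc_eq_Ioc (hp n.zero_le) (hp n.le_succ)]
    exact Ioc_disjoint_Ioc_of_le le_rfl

lemma lintegral_Ioo_ofReal {a b : ℝ} (hab : a ≤ b) {f : ℝ → ℝ} (hf : Continuous f)
    (h0 : ∀ x ∈ Ioo a b, 0 ≤ f x) :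
    ∫⁻ x in Ioo a b, ENNReal.ofReal (f x) = ENNReal.ofReal (∫ x in a..b, f x) := by
  rw [intervalIntegral.integral_of_le hab, integral_Ioc_eq_integral_Ioo,
    ofReal_integral_eq_lintegral_ofReal]
  · exact (hf.integrableOn_Icc (a := a) (b := b)).mono_set Ioo_subset_Icc_self
  · exact (ae_restrict_iff' measurableSet_Ioo).2 (ae_of_all _ h0)

/-- Inside a gap, the driver that is the closest one behind `u` is the left endpoint of the gap. -/
lemma forall_mem_arc_iff {N : ℕ} [NeZero N] (s : Fin N → unitInterval) {k : ℕ} (hk : k < N)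
    {u w : ℝ}
    (hu : u ∈ Ioo (unrolledPos s k) (unrolledPos s (k + 1))) :
    (∀ i, toCircle (s i) ∈ arc w (u : UnitAddCircle)) ↔ w < u - unrolledPos s k := by
  have hsub (i : Fin N) : (u : UnitAddCircle) - toCircle (sortedPos s i)
      = ((u - unrolledPos s i : ℝ) : UnitAddCircle) := by
    rw [unrolledPos_of_lt s i.2]; simp [toCircle]
  have hmono := monotone_unrolledPos s
  have hlt : u < unrolledPos s 0 + 1 :=
    hu.2.trans_le ((hmono (Nat.succ_le_of_lt hk)).trans_eq (unrolledPos_self s))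
  have hfr (i : Fin N) (hi : (i : ℕ) ≤ k) :
      Int.fract (u - unrolledPos s i) = u - unrolledPos s i := by
    have := hmono hi
    have := hmono (Nat.zero_le i)
    exact Int.fract_eq_self.2 ⟨by linarith [hu.1], by linarith⟩
  have key : (∀ i, toCircle (s i) ∈ arc w (u : UnitAddCircle)) ↔
      ∀ i, w < Int.fract (u - unrolledPos s (i : Fin N)) := by
    rw [← (Tuple.sort s).forall_congr_right]
    refine forall_congr' fun i => ?_
    rw [mem_arc, ← coord_coe, ← hsub]; rfl
  rw [key]
  constructor
  · intro h
    have := h ⟨k, hk⟩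
    rwa [hfr _ le_rfl] at this
  · intro h i
    rcases le_or_gt (i : ℕ) k with hi | hi
    · rw [hfr i hi]
      linarith [hmono hi]
    · have h1 := hmono (Nat.succ_le_of_lt hi)
      have h2 := (unrolledPos_mem s i.2).2
      have h3 := (unrolledPos_mem s hk).1
      have : Int.fract (u - unrolledPos s i) = u - unrolledPos s i + 1 :=
        Int.fract_eq_iff.2 ⟨by linarith [hu.1], by linarith [hu.2], -1, by push_cast; ring⟩
      rw [this]
      linarith

/-- The gap energy of a configuration is twice the probability that a random arc contains all
drivers: given its endpoint `u`, this happens when the length deleted behind `u` is less than the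
distance back to the previous driver, and that distance integrates to `ℓₖ² / 2` over the
`k`-th gap. -/
lemma ofReal_V_gaps {N : ℕ} [NeZero N] (s : Fin N → unitInterval) :
    ENNReal.ofReal (V (gaps s)) = energy (fun i => toCircle (s i)) := by
  have hmono := monotone_unrolledPos s
  have hmeas : MeasurableSet {q : UnitAddCircle × ℝ | ∀ i, toCircle (s i) ∈ arc q.2 q.1} :=
    measurableSet_mem_arc (fun i => measurable_const) measurable_fst measurable_snd
  have hE : energy (fun i => toCircle (s i)) = 2 * ∫⁻ u : UnitAddCircle,
      volume.restrict (Ioo (0 : ℝ) 1) {w | ∀ i, toCircle (s i) ∈ arc w u} := by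
    rw [energy]
    congr 1
    exact (lintegral_indicator_one hmeas).trans (Measure.prod_apply hmeas)
  rw [hE, ← UnitAddCircle.lintegral_preimage (unrolledPos s 0), ← unrolledPos_self,
    lintegral_Ioc_eq_sum hmono, ← Fin.sum_univ_eq_sum_range (fun k => ∫⁻ x in
      Ioc (unrolledPos s k) (unrolledPos s (k + 1)), volume.restrict (Ioo (0 : ℝ) 1)
        {w | ∀ i, toCircle (s i) ∈ arc w (x : UnitAddCircle)}) N, V, Finset.mul_sum,
    ENNReal.ofReal_sum_of_nonneg fun _ _ => sq_nonneg _]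
  refine Finset.sum_congr rfl fun k _ => ?_
  have hk := hmono (Nat.le_succ k)
  have hk1 : unrolledPos s (k + 1) ≤ unrolledPos s k + 1 := by
    have := hmono (Nat.zero_le k)
    have := hmono (Nat.succ_le_of_lt k.2)
    rw [unrolledPos_self] at this
    exact this.trans (by linarith)
  rw [Measure.restrict_congr_set Ioo_ae_eq_Ioc.symm, setLIntegral_congr_fun
    (g := fun u => ENNReal.ofReal (u - unrolledPos s k)) measurableSet_Ioo,
    lintegral_Ioo_ofReal hk (by fun_prop), gaps_eq_sub]
  · rw [← ENNReal.ofReal_ofNat, ← ENNReal.ofReal_mul (by norm_num)]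
    congr 1
    rw [intervalIntegral.integral_sub (by simp) (by simp), integral_id,
      intervalIntegral.integral_const, smul_eq_mul]
    ring
  · exact fun u hu => by linarith [hu.1]
  · intro u hu
    have : {w | ∀ i, toCircle (s i) ∈ arc w (u : UnitAddCircle)} = Iio (u - unrolledPos s k) := by
      ext w
      exact forall_mem_arc_iff s k.2 hu
    simp only [this]
    rw [Measure.restrict_apply measurableSet_Iio, Iio_inter_Ioo, Real.volume_Ioo, min_eq_left,
      sub_zero]
    linarith [hu.2]

lemma V_nonneg {N : ℕ} (l : Fin N → ℝ) : 0 ≤ V l := Finset.sum_nonneg fun _ _ => sq_nonneg _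

/-! ### Measurability of the gap vector -/

lemma measurable_sortedPos {N : ℕ} : Measurable (sortedPos : (Fin N → unitInterval) → _) := by
  let _ : MeasurableSpace (Equiv.Perm (Fin N)) := ⊤
  have : DiscreteMeasurableSpace (Equiv.Perm (Fin N)) := ⟨fun _ => trivial⟩
  have hsort : Measurable (fun s : Fin N → unitInterval => Tuple.sort s) := by
    refine measurable_to_countable' fun σ => ?_
    have : (fun s : Fin N → unitInterval => Tuple.sort s) ⁻¹' {σ} =
        {s | ∀ i j, (i ≤ j → s (σ i) ≤ s (σ j)) ∧ (i < j → s (σ i) = s (σ j) → σ i < σ j)} := by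
      ext s
      rw [mem_preimage, mem_singleton_iff, eq_comm, Tuple.eq_sort_iff]
      exact ⟨fun h i j => ⟨fun hij => h.1 hij, h.2 i j⟩,
        fun h => ⟨fun i j hij => (h i j).1 hij, fun i j => (h i j).2⟩⟩
    rw [this]
    simp only [ofPred_forall, ofPred_and]
    refine MeasurableSet.iInter fun i => MeasurableSet.iInter fun j => ?_
    refine MeasurableSet.inter ?_ ?_
    · by_cases h : i ≤ j
      · simpa [h] using measurableSet_le (measurable_pi_apply (σ i)) (measurable_pi_apply (σ j))
      · simp [h]
    · by_cases h : i < j ∧ ¬ σ i < σ j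
      · have he : MeasurableSet {s : Fin N → unitInterval | s (σ i) = s (σ j)} :=
          measurableSet_eq_fun (measurable_pi_apply (σ i)) (measurable_pi_apply (σ j))
        convert he.compl using 1
        ext s
        simp [h.1, h.2]
      · by_cases h1 : i < j
        · have h2 : σ i < σ j := not_not.1 fun h2 => h ⟨h1, h2⟩
          simp [h2]
        · simp [h1]
  refine measurable_pi_lambda _ fun k => ?_
  have hcont : Measurable fun a : Fin N × (Fin N → unitInterval) => a.2 a.1 :=
    measurable_from_prod_countable_right fun i => measurable_pi_apply i
  have hk : Measurable fun s : Fin N → unitInterval => Tuple.sort s k :=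
    (measurable_of_countable fun σ : Equiv.Perm (Fin N) => σ k).comp hsort
  exact hcont.comp (hk.prodMk measurable_id)

lemma measurable_gaps {N : ℕ} : Measurable (gaps : (Fin N → unitInterval) → _) := by
  have h (k : Fin N) : Measurable fun s : Fin N → unitInterval => (sortedPos s k : ℝ) :=
    measurable_subtype_coe.comp ((measurable_pi_apply k).comp measurable_sortedPos)
  refine measurable_pi_lambda _ fun k => ?_
  unfold gaps
  split_ifs with hk
  · exact (h _).sub (h _)
  · exact ((h _).const_sub 1).add (h _)

/-! ### The arcs that keep all drivers but the assigned one -/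

/-- The points of `arc w u` that are strictly farther from `x` than `z` is. -/
def farArc (w : ℝ) (u x z : UnitAddCircle) : Set UnitAddCircle :=
  arc w u ∩ {p | ‖x - z‖ < ‖x - p‖}

lemma measurable_volume_farArc (w : ℝ) :
    Measurable fun a : UnitAddCircle × UnitAddCircle × UnitAddCircle =>
      volume (farArc w a.1 a.2.1 a.2.2) := by
  have h1 : MeasurableSet {b : (UnitAddCircle × UnitAddCircle × UnitAddCircle) × UnitAddCircle |
      w < coord (b.1.1 - b.2)} :=
    measurableSet_lt measurable_const (measurable_coord.comp (by fun_prop))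
  have h2 : MeasurableSet {b : (UnitAddCircle × UnitAddCircle × UnitAddCircle) × UnitAddCircle |
      ‖b.1.2.1 - b.1.2.2‖ < ‖b.1.2.1 - b.2‖} :=
    measurableSet_lt (by fun_prop) (by fun_prop)
  exact measurable_measure_prodMk_left (h1.inter h2)

/-- The volume of the positions that the other drivers can take, to the power of their number,
counted only if `z` lies outside of the arc. -/
def removalWeight (M : ℕ) (w : ℝ) (u x z : UnitAddCircle) : ℝ≥0∞ :=
  (arc w u)ᶜ.indicator (fun z => volume (farArc w u x z) ^ M) z

lemma measurable_removalWeight (M : ℕ) (w : ℝ) :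
    Measurable fun a : UnitAddCircle × UnitAddCircle × UnitAddCircle =>
      removalWeight M w a.1 a.2.1 a.2.2 := by
  have : MeasurableSet {a : UnitAddCircle × UnitAddCircle × UnitAddCircle |
      w < coord (a.1 - a.2.2)} :=
    measurableSet_lt measurable_const (measurable_coord.comp (by fun_prop))
  exact ((measurable_volume_farArc w).pow_const M).indicator this.compl

lemma removalWeight_sub (M : ℕ) (w : ℝ) (u x z : UnitAddCircle) :
    removalWeight M w (u - z) (x - z) 0 = removalWeight M w u x z := by
  have h0 : (0 : UnitAddCircle) ∈ arc w (u - z) ↔ z ∈ arc w u := by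
    rw [← sub_mem_arc_sub (z := z) (u := u), sub_self]
  have h1 : volume (farArc w (u - z) (x - z) 0) = volume (farArc w u x z) := by
    rw [← measure_preimage_add_right volume (-z)]
    congr 1
    ext p
    simp only [farArc, mem_preimage, mem_inter_iff, mem_ofPred_eq, ← sub_eq_add_neg,
      sub_mem_arc_sub, sub_zero, sub_sub_sub_cancel_right]
  by_cases hz : z ∈ arc w u
  · simp [removalWeight, hz, h0]
  · simp [removalWeight, hz, h0, h1]

/-- By rotation invariance the removed driver may be placed at the origin. -/
lemma lintegral_removalWeight (M : ℕ) (w : ℝ) :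
    ∫⁻ u, ∫⁻ x, ∫⁻ z, removalWeight M w u x z = ∫⁻ u, ∫⁻ x, removalWeight M w u x 0 := by
  have hm := measurable_removalWeight M w
  have hm1 (u : UnitAddCircle) :
      Measurable fun a : UnitAddCircle × UnitAddCircle => removalWeight M w u a.1 a.2 := by
    have h : Measurable fun a : UnitAddCircle × UnitAddCircle => (u, a) :=
      measurable_const.prodMk measurable_id
    have h' := hm.comp h
    exact h'
  have hm2 : Measurable fun a : UnitAddCircle × UnitAddCircle =>
      ∫⁻ x, removalWeight M w a.1 x a.2 := by
    have h : Measurable fun b : (UnitAddCircle × UnitAddCircle) × UnitAddCircle =>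
      (b.1.1, b.2, b.1.2) := by fun_prop
    have h' := hm.comp h
    exact h'.lintegral_prod_right'
  calc ∫⁻ u, ∫⁻ x, ∫⁻ z, removalWeight M w u x z
      = ∫⁻ u, ∫⁻ z, ∫⁻ x, removalWeight M w u x z :=
        lintegral_congr fun u => lintegral_lintegral_swap (hm1 u).aemeasurable
    _ = ∫⁻ z, ∫⁻ u, ∫⁻ x, removalWeight M w u x z := lintegral_lintegral_swap hm2.aemeasurable
    _ = ∫⁻ z : UnitAddCircle, ∫⁻ u, ∫⁻ x, removalWeight M w u x 0 := by
        refine lintegral_congr fun z => ?_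
        calc ∫⁻ u, ∫⁻ x, removalWeight M w u x z
            = ∫⁻ u, ∫⁻ x, removalWeight M w (u - z) (x - z) 0 :=
              lintegral_congr fun u => lintegral_congr fun x => (removalWeight_sub M w u x z).symm
          _ = ∫⁻ u, ∫⁻ x, removalWeight M w (u - z) x 0 :=
              lintegral_congr fun u =>
                lintegral_sub_right_eq_self (fun x => removalWeight M w (u - z) x 0) z
          _ = ∫⁻ u, ∫⁻ x, removalWeight M w u x 0 :=
              lintegral_sub_right_eq_self (fun u => ∫⁻ x, removalWeight M w u x 0) z
    _ = ∫⁻ u, ∫⁻ x, removalWeight M w u x 0 := by simp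

lemma norm_coe_eq_min (x : ℝ) :
    ‖(x : UnitAddCircle)‖ = min (Int.fract x) (1 - Int.fract x) := by
  rw [UnitAddCircle.norm_eq, abs_sub_round_eq_min]

lemma ofReal_le_volume_of_Ioo_subset {A : Set UnitAddCircle} (hA : MeasurableSet A) {b c : ℝ}
    (hb : 0 ≤ b) (hc : c ≤ 1) (h : ∀ q ∈ Ioo b c, (q : UnitAddCircle) ∈ A) :
    ENNReal.ofReal (c - b) ≤ volume A := by
  rw [volume_eq_volume_Ioc_inter 0 hA, ← Real.volume_Ioo]
  refine measure_mono fun q hq => ⟨⟨hb.trans_lt hq.1, ?_⟩, h q hq⟩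
  linarith [hq.2]

lemma measurableSet_farArc (w : ℝ) (u x z : UnitAddCircle) : MeasurableSet (farArc w u x z) :=
  (measurableSet_arc w u).inter (measurableSet_lt measurable_const (by fun_prop))

section

variable {w a : ℝ}

lemma coe_mem_arc_coe (ha : a ∈ Ioo 0 w) {q : ℝ} (hq : q ∈ Ioo a (a + (1 - w))) :
    (q : UnitAddCircle) ∈ arc w (a : UnitAddCircle) := by
  have : Int.fract (a - q) = a - q + 1 :=
    Int.fract_eq_iff.2 ⟨by linarith [hq.2, ha.1, ha.2], by linarith [hq.1], -1, by push_cast; ring⟩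
  rw [mem_arc, ← AddCircle.coe_sub, coord_coe, this]
  linarith [hq.2]

lemma zero_notMem_arc_coe (hw : w < 1) (ha : a ∈ Ioo 0 w) :
    (0 : UnitAddCircle) ∉ arc w (a : UnitAddCircle) := by
  rw [mem_arc, sub_zero, coord_coe, Int.fract_eq_self.2 ⟨ha.1.le, ha.2.trans hw⟩, not_lt]
  exact ha.2.le

lemma removalWeight_zero (M : ℕ) (hw : w < 1) (ha : a ∈ Ioo 0 w) (x : UnitAddCircle) :
    removalWeight M w a x 0 = volume (farArc w a x 0) ^ M :=
  indicator_of_mem (zero_notMem_arc_coe hw ha) _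

/-- A user at `ξ < 1/2` is at distance `ξ` from the origin, and the points of the circle that are
closer fill the interval `(0, 2ξ)`. -/
lemma ofReal_pow_le_removalWeight_left (M : ℕ) (hw : w < 1) (ha : a ∈ Ioo 0 w) {ξ b : ℝ}
    (hξ : ξ ∈ Ioo 0 (1 / 2)) (hab : a ≤ b) (hb : 2 * ξ ≤ b) :
    ENNReal.ofReal (a + (1 - w) - b) ^ M ≤ removalWeight M w a ξ 0 := by
  rw [removalWeight_zero M hw ha]
  refine pow_le_pow_left' (ofReal_le_volume_of_Ioo_subset (measurableSet_farArc _ _ _ _)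
    (ha.1.le.trans hab) (by linarith [ha.2]) fun q hq => ⟨?_, ?_⟩) M
  · exact coe_mem_arc_coe ha ⟨by linarith [hq.1], hq.2⟩
  · have h1 : Int.fract ξ = ξ := Int.fract_eq_self.2 ⟨hξ.1.le, by linarith [hξ.2]⟩
    have h2 : Int.fract (ξ - q) = ξ - q + 1 := Int.fract_eq_iff.2
      ⟨by linarith [hq.2, ha.1, ha.2, hξ.1], by linarith [hq.1, hξ.1], -1, by push_cast; ring⟩
    rw [mem_ofPred_eq, sub_zero, ← AddCircle.coe_sub, norm_coe_eq_min, norm_coe_eq_min, h1, h2]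
    refine (min_le_left _ _).trans_lt (lt_min ?_ ?_) <;> linarith [hq.1, hq.2, ha.2]

/-- A user at `ξ > 1/2` is at distance `1 - ξ` from the origin, and the points of the circle that
are closer fill the interval `(2ξ - 1, 1)`. -/
lemma ofReal_pow_le_removalWeight_right (M : ℕ) (hw : w < 1) (ha : a ∈ Ioo 0 w) {ξ c : ℝ}
    (hξ : ξ ∈ Ioo (1 / 2) 1) (hc : c ≤ a + (1 - w)) (hc' : c ≤ 2 * ξ - 1) :
    ENNReal.ofReal (c - a) ^ M ≤ removalWeight M w a ξ 0 := by
  rw [removalWeight_zero M hw ha]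
  refine pow_le_pow_left' (ofReal_le_volume_of_Ioo_subset (measurableSet_farArc _ _ _ _)
    ha.1.le (by linarith [ha.2]) fun q hq => ⟨?_, ?_⟩) M
  · exact coe_mem_arc_coe ha ⟨hq.1, hq.2.trans_le hc⟩
  · have h1 : Int.fract ξ = ξ := Int.fract_eq_self.2 ⟨by linarith [hξ.1], hξ.2⟩
    have h2 : Int.fract (ξ - q) = ξ - q := Int.fract_eq_self.2
      ⟨by linarith [hq.2, hξ.2], by linarith [hq.1, ha.1, hξ.2]⟩
    rw [mem_ofPred_eq, sub_zero, ← AddCircle.coe_sub, norm_coe_eq_min, norm_coe_eq_min, h1, h2]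
    refine (min_le_right _ _).trans_lt (lt_min ?_ ?_) <;> linarith [hq.1, hq.2, ha.1]

lemma lintegral_Ioc_add_Ioc {b c d : ℝ} (h1 : b ≤ c) (h2 : c ≤ d) (f : ℝ → ℝ≥0∞) :
    (∫⁻ x in Ioc b c, f x) + ∫⁻ x in Ioc c d, f x = ∫⁻ x in Ioc b d, f x := by
  rw [← lintegral_union measurableSet_Ioc (Ioc_disjoint_Ioc_of_le le_rfl),
    Ioc_union_Ioc_eq_Ioc h1 h2]

lemma ofReal_intervalIntegral_le_lintegral {b c : ℝ} (hbc : b ≤ c) {f : ℝ → ℝ} (hf : Continuous f)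
    (h0 : ∀ x ∈ Ioo b c, 0 ≤ f x) {F : ℝ → ℝ≥0∞}
    (hF : ∀ x ∈ Ioo b c, ENNReal.ofReal (f x) ≤ F x) :
    ENNReal.ofReal (∫ x in b..c, f x) ≤ ∫⁻ x in Ioc b c, F x := by
  rw [← lintegral_Ioo_ofReal hbc hf h0, ← Measure.restrict_congr_set Ioo_ae_eq_Ioc]
  exact setLIntegral_mono' measurableSet_Ioo hF

/-- With the removed driver at the origin, the arc is the interval `(a, a + 1 - w)`. The user at `ξ`
excludes `(0, 2ξ)` or `(2ξ - 1, 1)` from it, which gives four ranges of `ξ` with an explicit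
integrand; the total does not depend on `a`. -/
lemma ofReal_le_lintegral_removalWeight (M : ℕ) (hw : w < 1) (ha : a ∈ Ioo 0 w) :
    ENNReal.ofReal (w * (1 - w) ^ M / 2 + (1 - w) ^ (M + 1) / (M + 1)) ≤
      ∫⁻ x, removalWeight M w a x 0 := by
  obtain ⟨ha0, haw⟩ := ha
  have hM : (0 : ℝ) < M + 1 := by positivity
  have hh : 0 < 1 - w := by linarith
  set F : ℝ → ℝ≥0∞ := fun ξ => removalWeight M w a (ξ : UnitAddCircle) 0
  rw [← UnitAddCircle.lintegral_preimage 0, zero_add]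
  have e1 : ENNReal.ofReal (∫ x in 0..a / 2, (1 - w) ^ M) ≤ ∫⁻ x in Ioc 0 (a / 2), F x := by
    refine ofReal_intervalIntegral_le_lintegral (by linarith) (by fun_prop)
      (fun _ _ => by positivity) fun ξ hξ => ?_
    rw [ENNReal.ofReal_pow hh.le]
    have := ofReal_pow_le_removalWeight_left M hw ⟨ha0, haw⟩ (ξ := ξ) (b := a)
      ⟨hξ.1, by linarith [hξ.2]⟩ le_rfl (by linarith [hξ.2])
    rwa [add_sub_cancel_left] at this
  have e2 : ENNReal.ofReal (∫ x in a / 2..(a + (1 - w)) / 2, (a + (1 - w) - 2 * x) ^ M) ≤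
      ∫⁻ x in Ioc (a / 2) ((a + (1 - w)) / 2), F x := by
    refine ofReal_intervalIntegral_le_lintegral (by linarith) (by fun_prop)
      (fun ξ hξ => pow_nonneg (by linarith [hξ.2]) M) fun ξ hξ => ?_
    rw [ENNReal.ofReal_pow (by linarith [hξ.2])]
    exact ofReal_pow_le_removalWeight_left M hw ⟨ha0, haw⟩
      ⟨by linarith [hξ.1], by linarith [hξ.2]⟩ (by linarith [hξ.1]) le_rfl
  have e3 : ENNReal.ofReal (∫ x in (1 + a) / 2..(1 + a + (1 - w)) / 2, (2 * x - (1 + a)) ^ M) ≤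
      ∫⁻ x in Ioc ((1 + a) / 2) ((1 + a + (1 - w)) / 2), F x := by
    refine ofReal_intervalIntegral_le_lintegral (by linarith) (by fun_prop)
      (fun ξ hξ => pow_nonneg (by linarith [hξ.1]) M) fun ξ hξ => ?_
    rw [ENNReal.ofReal_pow (by linarith [hξ.1]), ← sub_sub]
    exact ofReal_pow_le_removalWeight_right M hw ⟨ha0, haw⟩
      ⟨by linarith [hξ.1], by linarith [hξ.2]⟩ (by linarith [hξ.2]) le_rfl
  have e4 : ENNReal.ofReal (∫ x in (1 + a + (1 - w)) / 2..1, (1 - w) ^ M) ≤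
      ∫⁻ x in Ioc ((1 + a + (1 - w)) / 2) 1, F x := by
    refine ofReal_intervalIntegral_le_lintegral (by linarith) (by fun_prop)
      (fun _ _ => by positivity) fun ξ hξ => ?_
    rw [ENNReal.ofReal_pow hh.le]
    have := ofReal_pow_le_removalWeight_right M hw ⟨ha0, haw⟩ (ξ := ξ) (c := a + (1 - w))
      ⟨by linarith [hξ.1], hξ.2⟩ le_rfl (by linarith [hξ.1])
    rwa [add_sub_cancel_left] at this
  have i2 : ∫ x in a / 2..(a + (1 - w)) / 2, (a + (1 - w) - 2 * x) ^ M =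
      (1 - w) ^ (M + 1) / (2 * (M + 1)) := by
    rw [intervalIntegral.integral_comp_sub_mul (fun y => y ^ M) two_ne_zero, integral_pow,
      smul_eq_mul, show a + (1 - w) - 2 * ((a + (1 - w)) / 2) = 0 by ring,
      show a + (1 - w) - 2 * (a / 2) = 1 - w by ring, zero_pow M.succ_ne_zero]
    field_simp
    ring
  have i3 : ∫ x in (1 + a) / 2..(1 + a + (1 - w)) / 2, (2 * x - (1 + a)) ^ M =
      (1 - w) ^ (M + 1) / (2 * (M + 1)) := by
    rw [intervalIntegral.integral_comp_mul_sub (fun y => y ^ M) two_ne_zero, integral_pow,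
      smul_eq_mul, show 2 * ((1 + a) / 2) - (1 + a) = 0 by ring,
      show 2 * ((1 + a + (1 - w)) / 2) - (1 + a) = 1 - w by ring, zero_pow M.succ_ne_zero]
    field_simp
    ring
  have hpow : 0 ≤ (1 - w) ^ M := by positivity
  have hsum : ENNReal.ofReal (w * (1 - w) ^ M / 2 + (1 - w) ^ (M + 1) / (M + 1)) =
      ENNReal.ofReal (∫ x in 0..a / 2, (1 - w) ^ M)
      + ENNReal.ofReal (∫ x in a / 2..(a + (1 - w)) / 2, (a + (1 - w) - 2 * x) ^ M)
      + ENNReal.ofReal (∫ x in (1 + a) / 2..(1 + a + (1 - w)) / 2, (2 * x - (1 + a)) ^ M)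
      + ENNReal.ofReal (∫ x in (1 + a + (1 - w)) / 2..1, (1 - w) ^ M) := by
    rw [i2, i3, intervalIntegral.integral_const, intervalIntegral.integral_const, smul_eq_mul,
      smul_eq_mul]
    have p1 : 0 ≤ (a / 2 - 0) * (1 - w) ^ M := mul_nonneg (by linarith) hpow
    have p2 : 0 ≤ (1 - w) ^ (M + 1) / (2 * (M + 1)) := by positivity
    have p4 : 0 ≤ (1 - (1 + a + (1 - w)) / 2) * (1 - w) ^ M := mul_nonneg (by linarith) hpow
    rw [← ENNReal.ofReal_add p1 p2, ← ENNReal.ofReal_add (add_nonneg p1 p2) p2,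
      ← ENNReal.ofReal_add (add_nonneg (add_nonneg p1 p2) p2) p4]
    congr 1
    field_simp
    ring
  calc _ = _ := hsum
    _ ≤ (∫⁻ x in Ioc 0 (a / 2), F x) + (∫⁻ x in Ioc (a / 2) ((a + (1 - w)) / 2), F x)
        + (∫⁻ x in Ioc ((1 + a) / 2) ((1 + a + (1 - w)) / 2), F x)
        + ∫⁻ x in Ioc ((1 + a + (1 - w)) / 2) 1, F x := by gcongr
    _ ≤ (∫⁻ x in Ioc 0 ((1 + a) / 2), F x)
        + (∫⁻ x in Ioc ((1 + a) / 2) ((1 + a + (1 - w)) / 2), F x)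
        + ∫⁻ x in Ioc ((1 + a + (1 - w)) / 2) 1, F x := by
      -- For `ξ` between `(a + 1 - w) / 2` and `(1 + a) / 2` the whole arc is excluded.
      rw [lintegral_Ioc_add_Ioc (by linarith) (by linarith)]
      have hsub : Ioc 0 ((a + (1 - w)) / 2) ⊆ Ioc 0 ((1 + a) / 2) :=
        Ioc_subset_Ioc_right (by linarith)
      have := lintegral_mono_set (μ := volume) (f := F) hsub
      gcongr
    _ = ∫⁻ x in Ioc 0 1, F x := by
      rw [lintegral_Ioc_add_Ioc (by linarith) (by linarith),
        lintegral_Ioc_add_Ioc (by linarith) (by linarith)]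

/-- For a fixed deleted length `w`, a lower bound, in fact the value, for the probability that a
given driver is the closest one to the user and outside of the random arc while `M` others are
inside. -/
lemma ofReal_le_lintegral_removalWeight_three (M : ℕ) (hw : w ∈ Ioo (0 : ℝ) 1) :
    ENNReal.ofReal (w * (w * (1 - w) ^ M / 2 + (1 - w) ^ (M + 1) / (M + 1))) ≤
      ∫⁻ u, ∫⁻ x, ∫⁻ z, removalWeight M w u x z := by
  rw [lintegral_removalWeight, ← UnitAddCircle.lintegral_preimage 0, zero_add]
  calc ENNReal.ofReal (w * (w * (1 - w) ^ M / 2 + (1 - w) ^ (M + 1) / (M + 1)))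
      = ∫⁻ _ in Ioo (0 : ℝ) w,
          ENNReal.ofReal (w * (1 - w) ^ M / 2 + (1 - w) ^ (M + 1) / (M + 1)) := by
        rw [setLIntegral_const, Real.volume_Ioo, sub_zero, mul_comm, ENNReal.ofReal_mul' hw.1.le]
    _ ≤ ∫⁻ a in Ioo (0 : ℝ) w, ∫⁻ x, removalWeight M w (a : UnitAddCircle) x 0 :=
        setLIntegral_mono' measurableSet_Ioo fun a ha =>
          ofReal_le_lintegral_removalWeight M hw.2 ha
    _ ≤ ∫⁻ a in Ioc (0 : ℝ) 1, ∫⁻ x, removalWeight M w (a : UnitAddCircle) x 0 :=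
        lintegral_mono_set fun a ha => ⟨ha.1, (ha.2.trans hw.2).le⟩

end

/-! ### Expected energies before and after the replacement -/

/-- The joint law of the drivers' positions, the user and the new driver, as points of the
circle. -/
def configLaw (N : ℕ) : Measure ((Fin N → UnitAddCircle) × UnitAddCircle × UnitAddCircle) :=
  (volume : Measure (Fin N → UnitAddCircle)).prod
    ((volume : Measure UnitAddCircle).prod (volume : Measure UnitAddCircle))

instance : IsProbabilityMeasure (volume : Measure UnitAddCircle) := ⟨UnitAddCircle.measure_univ⟩

instance (N : ℕ) : IsProbabilityMeasure (configLaw N) := by unfold configLaw; infer_instance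

/-- All the drivers and the new driver lie in the random arc. -/
def allInArc (N : ℕ) :
    Set (((Fin N → UnitAddCircle) × UnitAddCircle × UnitAddCircle) × (UnitAddCircle × ℝ)) :=
  {b | (∀ i, b.1.1 i ∈ arc b.2.2 b.2.1) ∧ b.1.2.2 ∈ arc b.2.2 b.2.1}

/-- Driver `k` is strictly the closest to the user and is outside of the random arc, while the
other drivers and the new driver are inside. -/
def allButInArc {M : ℕ} (k : Fin (M + 1)) :
    Set (((Fin (M + 1) → UnitAddCircle) × UnitAddCircle × UnitAddCircle) × (UnitAddCircle × ℝ)) :=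
  {b | (b.1.1 k ∉ arc b.2.2 b.2.1 ∧
    ∀ j, b.1.1 (k.succAbove j) ∈ farArc b.2.2 b.2.1 b.1.2.1 (b.1.1 k)) ∧
      b.1.2.2 ∈ arc b.2.2 b.2.1}

lemma measurableSet_arc_preimage {α : Type*} [MeasurableSpace α] {f u : α → UnitAddCircle}
    {w : α → ℝ} (hf : Measurable f) (hu : Measurable u) (hw : Measurable w) :
    MeasurableSet {a | f a ∈ arc (w a) (u a)} :=
  measurableSet_lt hw (measurable_coord.comp (hu.sub hf))

lemma measurableSet_forall_mem_farArc {α ι : Type*} [MeasurableSpace α] [Countable ι]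
    {f : ι → α → UnitAddCircle} {u x z : α → UnitAddCircle} {w : α → ℝ}
    (hf : ∀ i, Measurable (f i)) (hu : Measurable u) (hw : Measurable w) (hx : Measurable x)
    (hz : Measurable z) : MeasurableSet {a | ∀ i, f i a ∈ farArc (w a) (u a) (x a) (z a)} := by
  rw [ofPred_forall]
  exact MeasurableSet.iInter fun i => (measurableSet_arc_preimage (hf i) hu hw).inter
    (measurableSet_lt (hx.sub hz).norm (hx.sub (hf i)).norm)

lemma measurableSet_allInArc (N : ℕ) : MeasurableSet (allInArc N) := by
  refine MeasurableSet.inter (measurableSet_mem_arc (fun i => ?_) ?_ ?_)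
    (measurableSet_arc_preimage ?_ ?_ ?_) <;> fun_prop

lemma measurableSet_allButInArc {M : ℕ} (k : Fin (M + 1)) : MeasurableSet (allButInArc k) := by
  refine MeasurableSet.inter (MeasurableSet.inter (measurableSet_arc_preimage ?_ ?_ ?_).compl
    (measurableSet_forall_mem_farArc (fun j => ?_) ?_ ?_ ?_ ?_))
    (measurableSet_arc_preimage ?_ ?_ ?_) <;> fun_prop

/-- If driver `k` is closest to the user at `x`, then the arcs containing all drivers after the
replacement of `k` include those containing all drivers and the new one, and those that miss
exactly `k`. -/
lemma arcLaw_add_sum_le_energy_update {M : ℕ} (s : Fin (M + 1) → UnitAddCircle)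
    (x y : UnitAddCircle) (k : Fin (M + 1)) (hk : ∀ j, ‖x - s k‖ ≤ ‖x - s j‖) :
    2 * (arcLaw (Prod.mk (s, x, y) ⁻¹' allInArc (M + 1)) +
      ∑ j, arcLaw (Prod.mk (s, x, y) ⁻¹' allButInArc j)) ≤ energy (Function.update s k y) := by
  -- Being strictly closest, driver `j` can only be `k`.
  have hzero (j : Fin (M + 1)) (hj : j ≠ k) :
      arcLaw (Prod.mk (s, x, y) ⁻¹' allButInArc j) = 0 := by
    have : Prod.mk (s, x, y) ⁻¹' allButInArc j = ∅ := by
      refine eq_empty_of_forall_notMem fun q hq => ?_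
      obtain ⟨i, hi⟩ := Fin.exists_succAbove_eq hj.symm
      have h : ‖x - s j‖ < ‖x - s (j.succAbove i)‖ := (hq.1.2 i).2
      rw [hi] at h
      exact (hk j).not_gt h
    rw [this, measure_empty]
  rw [Fintype.sum_eq_single k hzero, ← measure_union]
  · have hmeas : MeasurableSet {q : UnitAddCircle × ℝ |
        ∀ i, Function.update s k y i ∈ arc q.2 q.1} :=
      measurableSet_mem_arc (fun i => measurable_const) measurable_fst measurable_snd
    have hE : energy (Function.update s k y) =
        2 * arcLaw {q | ∀ i, Function.update s k y i ∈ arc q.2 q.1} := by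
      rw [← lintegral_indicator_one hmeas]; rfl
    rw [hE]
    gcongr
    rintro q hq i
    rcases eq_or_ne i k with rfl | hi
    · rw [Function.update_self]
      exact hq.elim (fun h => h.2) fun h => h.2
    · rw [Function.update_of_ne hi]
      obtain ⟨j, rfl⟩ := Fin.exists_succAbove_eq hi
      exact hq.elim (fun h => h.1 _) fun h => (h.1.2 j).1
  · exact disjoint_left.2 fun q hq hq' => hq'.1.1 (hq.1 k)
  · exact measurable_prodMk_left (measurableSet_allButInArc k)

lemma volume_forall_mem {N : ℕ} (A : Set UnitAddCircle) :
    volume {s : Fin N → UnitAddCircle | ∀ i, s i ∈ A} = volume A ^ N := by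
  have : {s : Fin N → UnitAddCircle | ∀ i, s i ∈ A} = univ.pi fun _ => A := by ext; simp
  rw [this, volume_pi_pi]
  simp

lemma configLaw_allInArc (N : ℕ) (u : UnitAddCircle) {w : ℝ} (hw : w ∈ Ioo (0 : ℝ) 1) :
    configLaw N ((fun a => (a, (u, w))) ⁻¹' allInArc N) = ENNReal.ofReal ((1 - w) ^ (N + 1)) := by
  have : (fun a : (Fin N → UnitAddCircle) × UnitAddCircle × UnitAddCircle => (a, (u, w))) ⁻¹'
      allInArc N = {s : Fin N → UnitAddCircle | ∀ i, s i ∈ arc w u} ×ˢ (univ ×ˢ arc w u) := by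
    ext; simp [allInArc]
  rw [this, configLaw, Measure.prod_prod, Measure.prod_prod, volume_forall_mem,
    UnitAddCircle.measure_univ, one_mul, ← pow_succ, volume_arc hw,
    ENNReal.ofReal_pow (by linarith [hw.2])]

/-- Conditionally on driver `k` at `z`, the other drivers independently fall into the far part of
the arc. -/
lemma volume_removal {M : ℕ} (k : Fin (M + 1)) (w : ℝ) (u x : UnitAddCircle) :
    volume {s : Fin (M + 1) → UnitAddCircle |
      s k ∉ arc w u ∧ ∀ j, s (k.succAbove j) ∈ farArc w u x (s k)} =
    ∫⁻ z, removalWeight M w u x z := by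
  set B : Set (UnitAddCircle × (Fin M → UnitAddCircle)) :=
    {a | a.1 ∉ arc w u ∧ ∀ j, a.2 j ∈ farArc w u x a.1} with hB
  have hBm : MeasurableSet B := by
    refine MeasurableSet.inter (measurableSet_arc_preimage ?_ ?_ ?_).compl
      (measurableSet_forall_mem_farArc (fun j => ?_) ?_ ?_ ?_ ?_) <;> fun_prop
  have hpre := (volume_preserving_piFinSuccAbove (fun _ : Fin (M + 1) => UnitAddCircle)
    k).measure_preimage hBm.nullMeasurableSet
  have hset : {s : Fin (M + 1) → UnitAddCircle |
      s k ∉ arc w u ∧ ∀ j, s (k.succAbove j) ∈ farArc w u x (s k)} =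
      (MeasurableEquiv.piFinSuccAbove (fun _ : Fin (M + 1) => UnitAddCircle) k) ⁻¹' B := rfl
  rw [hset, hpre, Measure.volume_eq_prod, Measure.prod_apply hBm]
  refine lintegral_congr fun z => ?_
  by_cases hz : z ∈ arc w u
  · simp [removalWeight, hB, hz]
  · have : Prod.mk z ⁻¹' B = {t : Fin M → UnitAddCircle | ∀ j, t j ∈ farArc w u x z} := by
      ext t; simp [hB, hz]
    rw [this, volume_forall_mem, removalWeight, indicator_of_mem hz]

lemma configLaw_allButInArc {M : ℕ} (k : Fin (M + 1)) (u : UnitAddCircle) {w : ℝ}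
    (hw : w ∈ Ioo (0 : ℝ) 1) :
    configLaw (M + 1) ((fun a => (a, (u, w))) ⁻¹' allButInArc k) =
      ENNReal.ofReal (1 - w) * ∫⁻ x, ∫⁻ z, removalWeight M w u x z := by
  have hm : MeasurableSet ((fun a => (a, (u, w))) ⁻¹' allButInArc k) :=
    measurable_prodMk_right (measurableSet_allButInArc k)
  have hsec (c : UnitAddCircle × UnitAddCircle) :
      volume ((fun s => (s, c)) ⁻¹' ((fun a => (a, (u, w))) ⁻¹' allButInArc k)) =
        (∫⁻ z, removalWeight M w u c.1 z) * (arc w u).indicator 1 c.2 := by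
    rw [← volume_removal k]
    by_cases hc : c.2 ∈ arc w u
    · rw [indicator_of_mem hc, Pi.one_apply, mul_one]
      congr 1
      ext s; simp [allButInArc, hc]
    · rw [indicator_of_notMem hc, mul_zero]
      convert measure_empty (μ := volume)
      ext s; simp [allButInArc, hc]
  have hx : Measurable fun x => ∫⁻ z, removalWeight M w u x z := by
    have h : Measurable fun a : UnitAddCircle × UnitAddCircle => (u, a) :=
      measurable_const.prodMk measurable_id
    have h' := (measurable_removalWeight M w).comp h
    exact h'.lintegral_prod_right'
  rw [configLaw, Measure.prod_apply_symm hm, lintegral_congr hsec,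
    lintegral_prod_mul hx.aemeasurable
      (measurable_one.indicator (measurableSet_arc w u)).aemeasurable,
    lintegral_indicator_one (measurableSet_arc w u), volume_arc hw, mul_comm]

lemma lintegral_arcLaw {F : UnitAddCircle × ℝ → ℝ≥0∞} (hF : Measurable F) :
    ∫⁻ q, F q ∂arcLaw = ∫⁻ w in Ioo (0 : ℝ) 1, ∫⁻ u, F (u, w) :=
  lintegral_prod_symm _ hF.aemeasurable

lemma lintegral_energy (N : ℕ) :
    ∫⁻ s : Fin N → UnitAddCircle, energy s = 2 * ENNReal.ofReal (1 / (N + 1)) := by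
  have hm : MeasurableSet {a : (Fin N → UnitAddCircle) × (UnitAddCircle × ℝ) |
      ∀ i, a.1 i ∈ arc a.2.2 a.2.1} :=
    measurableSet_mem_arc (fun i => by fun_prop) (by fun_prop) (by fun_prop)
  have h1 : ∫⁻ s : Fin N → UnitAddCircle, energy s = 2 *
      ((volume : Measure (Fin N → UnitAddCircle)).prod arcLaw)
        {a | ∀ i, a.1 i ∈ arc a.2.2 a.2.1} := by
    rw [Measure.prod_apply hm, ← lintegral_const_mul _ (measurable_measure_prodMk_left hm)]
    refine lintegral_congr fun s => ?_
    rw [← lintegral_indicator_one (measurable_prodMk_left hm)]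
    rfl
  rw [h1, Measure.prod_apply_symm hm, lintegral_arcLaw (measurable_measure_prodMk_right hm)]
  congr 1
  calc _ = ∫⁻ w in Ioo (0 : ℝ) 1, ENNReal.ofReal ((1 - w) ^ N) := by
        refine setLIntegral_congr_fun measurableSet_Ioo fun w hw => ?_
        have (u : UnitAddCircle) : volume ((fun s : Fin N → UnitAddCircle => (s, (u, w))) ⁻¹'
            {a | ∀ i, a.1 i ∈ arc a.2.2 a.2.1}) = ENNReal.ofReal ((1 - w) ^ N) := by
          rw [ENNReal.ofReal_pow (by linarith [hw.2]), ← volume_arc hw u, ← volume_forall_mem]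
          rfl
        simp only [this, lintegral_const, UnitAddCircle.measure_univ, mul_one]
    _ = _ := by
        rw [lintegral_Ioo_ofReal zero_le_one (by fun_prop)
          fun w hw => pow_nonneg (by linarith [hw.2]) N,
          intervalIntegral.integral_comp_sub_left (fun h => h ^ N) 1]
        simp

/-- With `M + 1` drivers, the density in the deleted length `w` of the probability that a random arc
contains all drivers after the replacement integrates to `1 / (M + 2)`, which is the probability
before the replacement, plus an excess that is positive for `M ≥ 2`. -/
lemma integral_energy_density (M : ℕ) :
    ∫ w in (0 : ℝ)..1, ((1 - w) ^ (M + 2) +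
      (M + 1) * ((1 - w) * (w * (w * (1 - w) ^ M / 2 + (1 - w) ^ (M + 1) / (M + 1))))) =
    1 / (M + 2) + (M - 1) / ((M + 2) * (M + 3) * (M + 4)) := by
  have hM : (0 : ℝ) < M + 1 := by positivity
  -- In terms of the arc length `h = 1 - w` the integrand is a sum of three monomials.
  have h (w : ℝ) : (1 - w) ^ (M + 2) +
      (M + 1) * ((1 - w) * (w * (w * (1 - w) ^ M / 2 + (1 - w) ^ (M + 1) / (M + 1)))) =
      (fun h : ℝ => (M + 1) / 2 * h ^ (M + 1) + (1 - M) * h ^ (M + 2) +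
        (M - 1) / 2 * h ^ (M + 3)) (1 - w) := by
    field_simp
    ring
  simp_rw [h]
  rw [intervalIntegral.integral_comp_sub_left (fun h : ℝ => (M + 1) / 2 * h ^ (M + 1) +
    (1 - M) * h ^ (M + 2) + (M - 1) / 2 * h ^ (M + 3)) 1,
    intervalIntegral.integral_add, intervalIntegral.integral_add,
    intervalIntegral.integral_const_mul, intervalIntegral.integral_const_mul,
    intervalIntegral.integral_const_mul, integral_pow, integral_pow, integral_pow]
  · simp only [sub_self, sub_zero, one_pow, Nat.cast_add, Nat.cast_one, Nat.cast_ofNat,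
      zero_pow (Nat.succ_ne_zero _)]
    field_simp
    ring
  all_goals exact Continuous.intervalIntegrable (by fun_prop) _ _

/-- The first term on the right is the case where the new driver joins an arc containing everybody,
the others are those where the assigned driver was the only one outside. -/
lemma ofReal_le_measure_arcs (M : ℕ) :
    ENNReal.ofReal (1 / (M + 2) + (M - 1) / ((M + 2) * (M + 3) * (M + 4))) ≤
      ((configLaw (M + 1)).prod arcLaw) (allInArc (M + 1)) +
        ∑ k : Fin (M + 1), ((configLaw (M + 1)).prod arcLaw) (allButInArc k) := by
  have hp (w : ℝ) (hw : w ∈ Ioo (0 : ℝ) 1) : 0 < 1 - w := by linarith [hw.2]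
  have hpos (w : ℝ) (hw : w ∈ Ioo (0 : ℝ) 1) :
      0 ≤ w * (w * (1 - w) ^ M / 2 + (1 - w) ^ (M + 1) / (M + 1)) := by
    have := hp w hw
    have := hw.1
    positivity
  rw [← integral_energy_density, ← lintegral_Ioo_ofReal zero_le_one (by fun_prop)
    fun w hw => add_nonneg (pow_nonneg (hp w hw).le _)
      (mul_nonneg (by positivity) (mul_nonneg (hp w hw).le (hpos w hw)))]
  have hF0 := measurable_measure_prodMk_right (μ := configLaw (M + 1))
    (measurableSet_allInArc (M + 1))
  have hF (k : Fin (M + 1)) := measurable_measure_prodMk_right (μ := configLaw (M + 1))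
    (measurableSet_allButInArc k)
  simp_rw [Measure.prod_apply_symm (measurableSet_allInArc _),
    Measure.prod_apply_symm (measurableSet_allButInArc _)]
  have hFs : Measurable fun q => configLaw (M + 1) ((fun a => (a, q)) ⁻¹' allInArc (M + 1)) +
      ∑ k, configLaw (M + 1) ((fun a => (a, q)) ⁻¹' allButInArc k) :=
    hF0.add (Finset.measurable_fun_sum _ fun k _ => hF k)
  rw [← lintegral_finsetSum _ fun k _ => hF k, ← lintegral_add_left hF0, lintegral_arcLaw hFs]
  refine setLIntegral_mono' measurableSet_Ioo fun w hw => ?_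
  have hF0' : Measurable fun u : UnitAddCircle =>
      configLaw (M + 1) ((fun a => (a, (u, w))) ⁻¹' allInArc (M + 1)) :=
    hF0.comp measurable_prodMk_right
  have hF' (k : Fin (M + 1)) : Measurable fun u : UnitAddCircle =>
      configLaw (M + 1) ((fun a => (a, (u, w))) ⁻¹' allButInArc k) :=
    (hF k).comp measurable_prodMk_right
  rw [lintegral_add_left hF0', lintegral_finsetSum _ fun k _ => hF' k]
  simp_rw [configLaw_allInArc _ _ hw, configLaw_allButInArc _ _ hw]
  rw [ENNReal.ofReal_add (pow_nonneg (hp w hw).le _)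
    (mul_nonneg (by positivity) (mul_nonneg (hp w hw).le (hpos w hw)))]
  refine add_le_add (by simp) ?_
  rw [Finset.sum_const, Finset.card_univ, Fintype.card_fin, nsmul_eq_mul,
    lintegral_const_mul' _ _ ENNReal.ofReal_ne_top, ENNReal.ofReal_mul (by positivity),
    ENNReal.ofReal_mul (hp w hw).le]
  have hcast : ENNReal.ofReal ((M : ℝ) + 1) = ((M + 1 : ℕ) : ℝ≥0∞) := by
    rw [← ENNReal.ofReal_natCast]; simp
  rw [hcast]
  gcongr
  exact ofReal_le_lintegral_removalWeight_three M hw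

/-! ### Almost sure uniqueness of the closest driver -/

instance : NullSingletonClass (volume : Measure UnitAddCircle) where
  measure_singleton x := by
    rw [← Metric.closedBall_zero, AddCircle.volume_closedBall]
    simp

lemma finite_norm_eq (c : ℝ) : {p : UnitAddCircle | ‖p‖ = c}.Finite := by
  refine (toFinite {(c : UnitAddCircle), ((-c : ℝ) : UnitAddCircle)}).subset fun p hp => ?_
  obtain ⟨r, rfl⟩ := QuotientAddGroup.mk_surjective p
  have hr : ((Int.fract r : ℝ) : UnitAddCircle) = (r : UnitAddCircle) := by
    rw [← coord_coe]; exact AddCircle.coe_equivIco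
  have hp' : ‖(r : UnitAddCircle)‖ = c := hp
  rw [norm_coe_eq_min] at hp'
  rcases min_choice (Int.fract r) (1 - Int.fract r) with h | h
  · left
    rw [← hp', h]; exact hr.symm
  · right
    have : ((-c : ℝ) : UnitAddCircle) = (r : UnitAddCircle) := by
      rw [← hp', h, neg_sub, AddCircle.coe_sub, hr, AddCircle.coe_period, sub_zero]
    exact this.symm

lemma volume_tie {M : ℕ} {i j : Fin (M + 1)} (hij : i ≠ j) (x : UnitAddCircle) :
    volume {s : Fin (M + 1) → UnitAddCircle | ‖x - s i‖ = ‖x - s j‖} = 0 := by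
  obtain ⟨k, rfl⟩ := Fin.exists_succAbove_eq hij.symm
  have hBm : MeasurableSet {a : UnitAddCircle × (Fin M → UnitAddCircle) |
      ‖x - a.1‖ = ‖x - a.2 k‖} := measurableSet_eq_fun (by fun_prop) (by fun_prop)
  have hpre := (volume_preserving_piFinSuccAbove (fun _ : Fin (M + 1) => UnitAddCircle)
    i).measure_preimage hBm.nullMeasurableSet
  refine hpre.trans ?_
  rw [Measure.volume_eq_prod, Measure.prod_apply_symm hBm]
  refine (lintegral_congr fun t => ?_).trans lintegral_zero
  have hfin : {z | ‖x - z‖ = ‖x - t k‖}.Finite :=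
    (finite_norm_eq ‖x - t k‖).preimage (sub_right_injective.injOn)
  exact hfin.measure_zero volume

lemma ae_no_tie (M : ℕ) :
    ∀ᵐ a ∂configLaw (M + 1), ∀ i j, i ≠ j → ‖a.2.1 - a.1 i‖ ≠ ‖a.2.1 - a.1 j‖ := by
  refine ae_all_iff.2 fun i => ae_all_iff.2 fun j => ?_
  by_cases hij : i = j
  · simp [hij]
  have hd (i : Fin (M + 1)) :
      Measurable fun a : (Fin (M + 1) → UnitAddCircle) × UnitAddCircle × UnitAddCircle =>
        ‖a.2.1 - a.1 i‖ := by fun_prop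
  have hm : MeasurableSet {a : (Fin (M + 1) → UnitAddCircle) × UnitAddCircle × UnitAddCircle |
      ‖a.2.1 - a.1 i‖ = ‖a.2.1 - a.1 j‖} := measurableSet_eq_fun (hd i) (hd j)
  have hsec (c : UnitAddCircle × UnitAddCircle) :
      volume ((fun s : Fin (M + 1) → UnitAddCircle => (s, c)) ⁻¹'
        {a | ‖a.2.1 - a.1 i‖ = ‖a.2.1 - a.1 j‖}) = 0 := volume_tie hij c.1
  have hnull : configLaw (M + 1) {a | ‖a.2.1 - a.1 i‖ = ‖a.2.1 - a.1 j‖} = 0 := by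
    rw [configLaw, Measure.prod_apply_symm hm, lintegral_congr hsec, lintegral_zero]
  have hae := measure_eq_zero_iff_ae_notMem.1 hnull
  filter_upwards [hae] with a ha _ using ha

lemma measurable_energy_update {ι : Type*} [Countable ι] [DecidableEq ι] (k : ι) :
    Measurable fun a : (ι → UnitAddCircle) × UnitAddCircle =>
      energy (Function.update a.1 k a.2) := by
  refine measurable_energy.comp (measurable_pi_lambda _ fun i => ?_)
  rcases eq_or_ne i k with rfl | hi
  · simpa using measurable_snd
  · simp only [Function.update_of_ne hi]
    fun_prop

/-! ### The law of the configuration -/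

section

variable {Ω : Type*} [MeasurableSpace Ω] {μ : Measure Ω}

lemma map_toCircle {X : Ω → unitInterval} (hX : Measurable X) (hX_unif : μ.map X = volume) :
    μ.map (fun ω => toCircle (X ω)) = volume := by
  have := Measure.map_map measurePreserving_toCircle.measurable hX (μ := μ)
  rw [hX_unif, measurePreserving_toCircle.map_eq] at this
  exact this.symm

lemma map_config [IsProbabilityMeasure μ] {N : ℕ} {S : Ω → Fin N → unitInterval} (hS : Measurable S)
    (hS_unif : ∀ i, μ.map (fun ω => S ω i) = volume)
    (hS_indep : iIndepFun (fun i ω => S ω i) μ)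
    {X Y : Ω → unitInterval} (hX : Measurable X) (hY : Measurable Y)
    (hX_unif : μ.map X = volume) (hY_unif : μ.map Y = volume)
    (hXY_indep : IndepFun X Y μ)
    (hSXY_indep : IndepFun S (fun ω => (X ω, Y ω)) μ) :
    μ.map (fun ω => ((fun i => toCircle (S ω i)), toCircle (X ω), toCircle (Y ω))) =
      configLaw N := by
  have hc : Measurable toCircle := measurePreserving_toCircle.measurable
  have hSi (i : Fin N) : Measurable fun ω => S ω i := (measurable_pi_apply i).comp hS
  have hSc : Measurable fun ω => (fun i => toCircle (S ω i)) :=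
    measurable_pi_lambda _ fun i => hc.comp (hSi i)
  have h1 : μ.map (fun ω => (fun i => toCircle (S ω i))) = volume := by
    have h := (iIndepFun_iff_map_fun_eq_pi_map fun i => (hc.comp (hSi i)).aemeasurable).1
      (hS_indep.comp (fun _ => toCircle) fun _ => hc)
    refine h.trans ?_
    rw [volume_pi]
    congr 1
    funext i
    exact map_toCircle (hSi i) (hS_unif i)
  have h2 : μ.map (fun ω => (toCircle (X ω), toCircle (Y ω))) =
      (volume : Measure UnitAddCircle).prod volume := by
    have h := (indepFun_iff_map_prod_eq_prod_map_map (hc.comp hX).aemeasurable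
      (hc.comp hY).aemeasurable).1 (hXY_indep.comp hc hc)
    refine h.trans ?_
    congr 1
    · exact map_toCircle hX hX_unif
    · exact map_toCircle hY hY_unif
  have hind : IndepFun (fun ω => (fun i => toCircle (S ω i)))
      (fun ω => (toCircle (X ω), toCircle (Y ω))) μ := by
    have hg : Measurable fun s : Fin N → unitInterval => (fun i => toCircle (s i)) :=
      measurable_pi_lambda _ fun i => hc.comp (measurable_pi_apply i)
    have hg' : Measurable fun c : unitInterval × unitInterval => (toCircle c.1, toCircle c.2) :=
      (hc.comp measurable_fst).prodMk (hc.comp measurable_snd)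
    exact hSXY_indep.comp hg hg'
  have h := (indepFun_iff_map_prod_eq_prod_map_map hSc.aemeasurable
    ((hc.comp hX).prodMk (hc.comp hY)).aemeasurable).1 hind
  rw [configLaw, ← h1, ← h2]
  exact h

end

/-! ### The expected change of the energy -/

/-- The choice of the assigned driver need not be measurable, but almost surely there is only one
closest driver, so that the energy after the replacement agrees almost surely with a measurable
function. -/
lemma aemeasurable_energy_update {Ω : Type*} [MeasurableSpace Ω] {μ : Measure Ω} {M : ℕ}
    {s : Ω → Fin (M + 1) → UnitAddCircle} {x y : Ω → UnitAddCircle}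
    (hm : Measurable fun ω => (s ω, x ω, y ω))
    (hlaw : μ.map (fun ω => (s ω, x ω, y ω)) = configLaw (M + 1))
    {K : Ω → Fin (M + 1)} (hK : ∀ ω j, ‖x ω - s ω (K ω)‖ ≤ ‖x ω - s ω j‖) :
    AEMeasurable (fun ω => energy (Function.update (s ω) (K ω) (y ω))) μ := by
  have hs : Measurable s := measurable_fst.comp hm
  have hx : Measurable x := measurable_fst.comp (measurable_snd.comp hm)
  have hy : Measurable y := measurable_snd.comp (measurable_snd.comp hm)
  have hsi (i : Fin (M + 1)) : Measurable fun ω => s ω i := (measurable_pi_apply i).comp hs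
  have hset (k : Fin (M + 1)) : MeasurableSet {ω | ∀ j, ‖x ω - s ω k‖ ≤ ‖x ω - s ω j‖} := by
    rw [ofPred_forall]
    exact MeasurableSet.iInter fun j =>
      measurableSet_le (hx.sub (hsi k)).norm (hx.sub (hsi j)).norm
  refine ⟨fun ω => ∑ k, {ω | ∀ j, ‖x ω - s ω k‖ ≤ ‖x ω - s ω j‖}.indicator
    (fun ω => energy (Function.update (s ω) k (y ω))) ω, ?_, ?_⟩
  · refine Finset.measurable_fun_sum _ fun k _ => Measurable.indicator ?_ (hset k)
    have h' := (measurable_energy_update k).comp (hs.prodMk hy)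
    exact h'
  · have hae := ae_no_tie M
    rw [← hlaw] at hae
    filter_upwards [ae_of_ae_map hm.aemeasurable hae] with ω hω
    rw [Fintype.sum_eq_single (K ω)]
    · have hω' : ω ∈ {ω' | ∀ j, ‖x ω' - s ω' (K ω)‖ ≤ ‖x ω' - s ω' j‖} := hK ω
      rw [indicator_of_mem hω']
    · intro k hk
      refine indicator_of_notMem (fun h => ?_) _
      exact hω k (K ω) hk (le_antisymm (h (K ω)) (hK ω k))

lemma two_mul_lt_lintegral_energy_update {Ω : Type*} [MeasurableSpace Ω] {μ : Measure Ω} {M : ℕ}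
    (hM : 2 ≤ M) {s : Ω → Fin (M + 1) → UnitAddCircle} {x y : Ω → UnitAddCircle}
    (hm : Measurable fun ω => (s ω, x ω, y ω))
    (hlaw : μ.map (fun ω => (s ω, x ω, y ω)) = configLaw (M + 1))
    {K : Ω → Fin (M + 1)} (hK : ∀ ω j, ‖x ω - s ω (K ω)‖ ≤ ‖x ω - s ω j‖) :
    2 * ENNReal.ofReal (1 / (M + 2)) < ∫⁻ ω, energy (Function.update (s ω) (K ω) (y ω)) ∂μ := by
  have hF0 := measurable_measure_prodMk_left (ν := arcLaw) (measurableSet_allInArc (M + 1))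
  have hF (k : Fin (M + 1)) :=
    measurable_measure_prodMk_left (ν := arcLaw) (measurableSet_allButInArc k)
  have hFs : Measurable fun a => arcLaw (Prod.mk a ⁻¹' allInArc (M + 1)) +
      ∑ k : Fin (M + 1), arcLaw (Prod.mk a ⁻¹' allButInArc k) :=
    hF0.add (Finset.measurable_fun_sum _ fun k _ => hF k)
  have hM' : (2 : ℝ) ≤ M := by exact_mod_cast hM
  calc 2 * ENNReal.ofReal (1 / (M + 2))
      < 2 * ENNReal.ofReal (1 / (M + 2) + (M - 1) / ((M + 2) * (M + 3) * (M + 4))) := by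
        have hpos : 0 < ((M : ℝ) - 1) / ((M + 2) * (M + 3) * (M + 4)) := by
          have : 0 < (M : ℝ) - 1 := by linarith
          positivity
        refine (ENNReal.mul_lt_mul_iff_right two_ne_zero ENNReal.ofNat_ne_top).2 ?_
        exact (ENNReal.ofReal_lt_ofReal_iff (by positivity)).2 (by linarith)
    _ ≤ 2 * (((configLaw (M + 1)).prod arcLaw) (allInArc (M + 1)) +
        ∑ k : Fin (M + 1), ((configLaw (M + 1)).prod arcLaw) (allButInArc k)) := by
        gcongr
        exact ofReal_le_measure_arcs M
    _ = ∫⁻ a, 2 * (arcLaw (Prod.mk a ⁻¹' allInArc (M + 1)) +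
        ∑ k : Fin (M + 1), arcLaw (Prod.mk a ⁻¹' allButInArc k)) ∂configLaw (M + 1) := by
        rw [lintegral_const_mul _ hFs, lintegral_add_left hF0,
          lintegral_finsetSum _ fun k _ => hF k]
        simp_rw [Measure.prod_apply (measurableSet_allInArc _),
          Measure.prod_apply (measurableSet_allButInArc _)]
    _ = ∫⁻ ω, 2 * (arcLaw (Prod.mk (s ω, x ω, y ω) ⁻¹' allInArc (M + 1)) +
        ∑ k : Fin (M + 1), arcLaw (Prod.mk (s ω, x ω, y ω) ⁻¹' allButInArc k)) ∂μ := by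
        rw [← hlaw, lintegral_map (hFs.const_mul 2) hm]
    _ ≤ _ := lintegral_mono fun ω =>
        arcLaw_add_sum_le_energy_update (s ω) (x ω) (y ω) (K ω) (hK ω)

end GreedyCircle

end

theorem mainTheorem1 {Ω : Type*} [MeasurableSpace Ω] (μ : Measure Ω) [IsProbabilityMeasure μ]
    (N : ℕ) (hN : 3 ≤ N)
    -- drivers' positions: independent and uniform
    (S : Ω → Fin N → unitInterval) (hS : Measurable S)
    (hS_unif : ∀ i, μ.map (fun ω => S ω i) = volume)
    (hS_indep : iIndepFun (fun i ω => S ω i) μ)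
    -- the new user `X` and the new driver `Y`: uniform, independent of each other and of `S`
    (X Y : Ω → unitInterval) (hX : Measurable X) (hY : Measurable Y)
    (hX_unif : μ.map X = volume) (hY_unif : μ.map Y = volume)
    (hXY_indep : IndepFun X Y μ)
    (hSXY_indep : IndepFun S (fun ω => (X ω, Y ω)) μ)
    -- greedy assignment: `K` is a driver closest to the user, with ties broken arbitrarily
    (K : Ω → Fin N) (hK : ∀ ω, GreedyCircle.IsNearest (S ω) (X ω) (K ω)) :
    0 < ∫ ω, GreedyCircle.deltaV μ S K Y ω ∂μ := by
  open GreedyCircle in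
  obtain ⟨M, rfl⟩ : ∃ M, N = M + 1 := ⟨N - 1, by omega⟩
  have hc : Measurable toCircle := measurePreserving_toCircle.measurable
  set s : Ω → Fin (M + 1) → UnitAddCircle := fun ω i => toCircle (S ω i)
  have hs : Measurable s :=
    measurable_pi_lambda _ fun i => hc.comp ((measurable_pi_apply i).comp hS)
  have hm : Measurable fun ω => (s ω, toCircle (X ω), toCircle (Y ω)) :=
    hs.prodMk ((hc.comp hX).prodMk (hc.comp hY))
  have hlaw : μ.map (fun ω => (s ω, toCircle (X ω), toCircle (Y ω))) = configLaw (M + 1) :=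
    map_config hS hS_unif hS_indep hX hY hX_unif hY_unif hXY_indep hSXY_indep
  have hlaw_s : μ.map s = volume := by
    have h := congrArg (Measure.map Prod.fst) hlaw
    rw [Measure.map_map measurable_fst hm, configLaw, Measure.map_fst_prod, measure_univ,
      one_smul] at h
    exact h
  have hK' (ω : Ω) (j : Fin (M + 1)) :
      ‖toCircle (X ω) - s ω (K ω)‖ ≤ ‖toCircle (X ω) - s ω j‖ := by
    have := hK ω j
    rwa [arcDist_eq_norm, arcDist_eq_norm] at this
  set e₁ : Ω → ENNReal := fun ω => energy (Function.update (s ω) (K ω) (toCircle (Y ω)))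
  set e₀ : Ω → ENNReal := fun ω => energy (s ω)
  have hV₀ (ω : Ω) : V (gaps (S ω)) = (e₀ ω).toReal := by
    rw [← ENNReal.toReal_ofReal (V_nonneg (gaps (S ω))), ofReal_V_gaps]
  have hV₁ (ω : Ω) : V (gaps (nextPos (S ω) (K ω) (Y ω))) = (e₁ ω).toReal := by
    rw [← ENNReal.toReal_ofReal (V_nonneg (gaps (nextPos _ _ _))), ofReal_V_gaps]
    congr 2
    funext i
    exact Function.apply_update (fun _ => toCircle) (S ω) (K ω) (Y ω) i
  have hm₀ : AEMeasurable e₀ μ := (measurable_energy.comp hs).aemeasurable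
  have hm₁ : AEMeasurable e₁ μ := aemeasurable_energy_update hm hlaw hK'
  have hfin {e : Ω → ENNReal} (he : ∀ ω, e ω ≤ 2) : ∀ᵐ ω ∂μ, e ω < ⊤ :=
    ae_of_all _ fun ω => (he ω).trans_lt ENNReal.ofNat_lt_top
  have hint {e : Ω → ENNReal} (hme : AEMeasurable e μ) (he : ∀ ω, e ω ≤ 2) :
      Integrable (fun ω => (e ω).toReal) μ := by
    refine Integrable.of_bound hme.ennreal_toReal.aestronglyMeasurable 2 (ae_of_all _ fun ω => ?_)
    rw [Real.norm_of_nonneg ENNReal.toReal_nonneg]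
    exact ENNReal.toReal_mono ENNReal.ofNat_ne_top (he ω)
  have hlt : ∫⁻ ω, e₀ ω ∂μ < ∫⁻ ω, e₁ ω ∂μ := by
    have h0 : ∫⁻ ω, e₀ ω ∂μ = 2 * ENNReal.ofReal (1 / (M + 2)) := by
      have h := lintegral_map (μ := μ) (measurable_energy (ι := Fin (M + 1))) hs
      rw [hlaw_s, lintegral_energy] at h
      rw [← h]
      congr 3
      push_cast
      ring
    rw [h0]
    exact two_mul_lt_lintegral_energy_update (by omega) hm hlaw hK'
  have hne : ∫⁻ ω, e₁ ω ∂μ ≠ ⊤ := by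
    refine ne_top_of_le_ne_top ENNReal.ofNat_ne_top (b := 2) ?_
    calc ∫⁻ ω, e₁ ω ∂μ ≤ ∫⁻ _, 2 ∂μ := lintegral_mono fun ω => energy_le_two _
      _ = 2 := by simp
  have hmg : Measurable fun ω => gaps (S ω) := measurable_gaps.comp hS
  unfold deltaV
  rw [integral_condExp hmg.comap_le]
  simp_rw [hV₀, hV₁]
  rw [integral_sub (hint hm₁ fun _ => energy_le_two _) (hint hm₀ fun _ => energy_le_two _),
    integral_toReal hm₁ (hfin fun _ => energy_le_two _),
    integral_toReal hm₀ (hfin fun _ => energy_le_two _), sub_pos]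
  exact (ENNReal.toReal_lt_toReal (hlt.trans_le le_top).ne hne).2 hlt
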